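/- Let $\mathsf A$ be a finite alphabet, let $\Omega=\mathsf A^{\mathbb N}$ carry its Borel $\sigma$-field and coordinate process $(X_k)_{k\ge1}$, and write $x_{m:n}=(x_m,\dots,x_n)$, $\mathbf P(x_{1:n})=\mathbf P[X_{1:n}=x_{1:n}]$ and $\mathbf P(x_{1:n}|x_{1:r})=\mathbf P[X_{1:n}=x_{1:n}\,|\,X_{1:r}=x_{1:r}]$. For $r\ge0$ let $\Theta^r$ be the set of laws on $\Omega$ of time homogeneous Markov chains of order at most $r$, that is, of probability measures $\mathbf P$ for which there is a transition probability $p$ from $\mathsf A^r$ to $\mathsf A$ with $$\mathbf P(x_{1:n})=\mathbf P(x_{1:r})\prod_{i=r+1}^n p(x_i|x_{i-r:i-1})\qquad\text{for all }n\ge r,\ x_{1:n}\in\mathsf A^n;$$ the order of $\mathbf P$ is the smallest $r$ with $\mathbf P\in\Theta^r$. Let $\mathbf P^\star$ be the law of a stationary irreducible Markov chain of order $r^\star$ (irreducible: in the chain of blocks of length $r^\star$, any block of positive probability can be reached from any other). For $a_{1:r}\in\mathsf A^r$ put $N_n(a_{1:r})=\sum_{i=r+1}^n\mathbf 1_{x_{i-r:i-1}=a_{1:r}}$.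 Let $\eta<1$, let $\rho(n)$, $n\ge1$, be a real-valued nondecreasing function with $\rho(n)\le n/2$, and define $F_n=G_n\cap G_{2n}$, where $G_n$ is the event $$\left\{\left|\frac{1}{\mathbf P^\star(a_{1:r})}\frac{N_n(a_{1:r})}{n-r}-1\right|\le\eta\ \text{ for all } r<\rho(n)\text{ and all }a_{1:r}\in\mathsf A^r\text{ with }\mathbf P^\star(a_{1:r})>0\right\}.$$ Then there exist constants $C_1,C_1',C_2>0$, where $C_1,C_1'$ depend only on $\eta$ and $C_2$ depends only on $\eta$ and on the size $|\mathsf A|$ of the alphabet, such that $$\mathbf P^\star\left[F_n\cap\left\{\max_{i=n,\dots,2n}\left(\sup_{\mathbf P\in\Theta^r}\log\mathbf P(x_{1:i})-\log\mathbf P^\star(x_{1:i}|x_{1:r})\right)\ge\varepsilon\right\}\right]\le C_1'\,e^{-\varepsilon/C_1}$$ for all $n\ge1$, all integers $r$ with $r^\star<r<\rho(n)$, and all $\varepsilon\ge C_2|\mathsf A|^r$ (with the convention $\log0=-\infty$). -/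

import Mathlib

open MeasureTheory

namespace MarkovOrder

variable {A : Type*}

/-- The block of length `r` of the path `x` that starts after the first `m` letters.  Paths are
indexed by `ℕ` from `0`, so the letter usually written `x_k` (`k ≥ 1`) is `x (k - 1)`, and
`block m r x` is the word `x_{m+1:m+r}`. -/
def block (m r : ℕ) (x : ℕ → A) : Fin r → A := fun j => x (m + j)

/-- The event `X_{m+1:m+r} = a_{1:r}`. -/
def blockEvent (m : ℕ) {r : ℕ} (a : Fin r → A) : Set (ℕ → A) := {x | block m r x = a}

/-- The event that the path starts with the same `n` letters as `x`; its probability under `P`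
is `P(x_{1:n})`. -/
def prefixEvent (n : ℕ) (x : ℕ → A) : Set (ℕ → A) := blockEvent 0 (block 0 n x)

/-- The class `Θ^r` of all laws of time homogeneous Markov chains of order at most `r`:
probability measures `P` for which there is a transition probability `p` with
`P(x_{1:n}) = P(x_{1:r}) ∏_{i=r+1}^n p(x_i | x_{i-r:i-1})` for all `n ≥ r` and all `x`.
(Values of `p` at words that have probability zero at all times are immaterial.) -/
def markovClass (A : Type*) [Fintype A] [MeasurableSpace A] (r : ℕ) :
    Set (Measure (ℕ → A)) :=
  {P | IsProbabilityMeasure P ∧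
    ∃ p : (Fin r → A) → A → ℝ,
      (∀ a b, 0 ≤ p a b) ∧ (∀ a, ∑ b, p a b = 1) ∧
      ∀ (n : ℕ) (x : ℕ → A),
        P.real (prefixEvent (r + n) x) =
          P.real (prefixEvent r x) * ∏ i ∈ Finset.range n, p (block i r x) (x (i + r))}

/-- `P` is the law of a Markov chain whose order is exactly `r`. -/
def HasOrder [Fintype A] [MeasurableSpace A] (P : Measure (ℕ → A)) (r : ℕ) : Prop :=
  IsLeast {s : ℕ | P ∈ markovClass A s} r

/-- Stationarity: the law is invariant under the shift. -/
def IsStationary [MeasurableSpace A] (P : Measure (ℕ → A)) : Prop :=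
  MeasurePreserving (fun (x : ℕ → A) (i : ℕ) => x (i + 1)) P P

/-- Irreducibility of a stationary chain of order (at most) `r`: in the Markov chain of
`r`-blocks, whose states are the words of length `r` of positive probability, every state can be
reached from every other state. -/
def IsIrreducible [MeasurableSpace A] (P : Measure (ℕ → A)) (r : ℕ) : Prop :=
  ∀ a b : Fin r → A, 0 < P (blockEvent 0 a) → 0 < P (blockEvent 0 b) →
    ∃ k : ℕ, 0 < ProbabilityTheory.cond P (blockEvent 0 a) (blockEvent k b)

open Classical in
/-- `N_n(a_{1:r}) = ∑_{i=r+1}^n 1_{x_{i-r:i-1} = a_{1:r}}`, the number of times that the word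
`a_{1:r}` occurs in `x_{1:n-1}`. -/
noncomputable def blockCount (n : ℕ) {r : ℕ} (a : Fin r → A) (x : ℕ → A) : ℕ :=
  ∑ i ∈ Finset.Icc (r + 1) n, if block (i - r - 1) r x = a then 1 else 0

/-- The event `G_n`: at time `n`, the empirical frequencies of all words of positive probability
and of length `r < ρ(n)` are within relative error `η` of their probabilities. -/
def typicalEvent [MeasurableSpace A] (P : Measure (ℕ → A)) (η : ℝ) (ρ : ℕ → ℝ) (n : ℕ) :
    Set (ℕ → A) :=
  {x | ∀ r : ℕ, (r : ℝ) < ρ n → ∀ a : Fin r → A, 0 < P.real (blockEvent 0 a) →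
    |1 / P.real (blockEvent 0 a) * ((blockCount n a x : ℝ) / ((n : ℝ) - (r : ℝ))) - 1| ≤ η}

/-- The maximal log-likelihood `sup_{P ∈ Θ^r} log P(x_{1:i})`, with `log 0 = -∞`. -/
noncomputable def maxLogLik [Fintype A] [MeasurableSpace A] (r i : ℕ) (x : ℕ → A) : EReal :=
  ⨆ P ∈ markovClass A r, ENNReal.log (P (prefixEvent i x))

/-- The conditional log-likelihood `log P(x_{1:i} | x_{1:r})`, with `log 0 = -∞`. -/
noncomputable def condLogLik [MeasurableSpace A] (P : Measure (ℕ → A)) (r i : ℕ)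
    (x : ℕ → A) : EReal :=
  ENNReal.log (ProbabilityTheory.cond P (prefixEvent r x) (prefixEvent i x))

end MarkovOrder

/-! Along almost every path, the log-likelihood gain over the true chain of any chain of order at
most `r` is at most a sum, over pairs (word, letter), of Poisson relative entropies between the
transition count `k` and its compensator `l`, the word count times the true transition probability
(`HasTransition.maxLogLik_sub_condLogLik_le`). The Poisson form decouples the pairs: for each family
of parameters `θ`, the product over pairs of `exp (θ k - l (exp θ - 1))` is a nonnegative
supermartingale, and so is a mixture of such products.

The entropy is the supremum over `θ` of these exponents, but the optimal `θ` depends on the path. On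
the typical event each `l` lies in a deterministic interval `[l₀, K l₀]` with `K = 6 / (1 - η)`,
throughout times `n` to `2n` (`wordCount_bounds`). A finite grid of `θ` depending only on `l₀` and a
truncation level then suffices: the mixture over the grid dominates `c exp (entropy / (4K))` up to
that level (`exists_mixture_ge`). Multiplying over pairs, an excess of at least `ε` at any of these
times forces one supermartingale, started below 1, above `c ^ (|A| ^ (r + 1)) exp (ε / (4K))`. The
maximal inequality handles all times at once, without a union bound, and half of the exponent
absorbs the power of `c` when `ε ≥ C₂ |A| ^ r`. -/

namespace MarkovOrder

open InformationTheory Finset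

/-! ### Poisson relative entropy -/

/-- The relative entropy of Poisson laws: `poissonEntropy k l` is the supremum over `θ` of
`θ * k - l * (exp θ - 1)`. -/
noncomputable def poissonEntropy (k l : ℝ) : ℝ := k * Real.log (k / l) - k + l

lemma poissonEntropy_eq_mul_klFun {k l : ℝ} (hl : 0 < l) :
    poissonEntropy k l = l * klFun (k / l) := by
  unfold poissonEntropy klFun
  field_simp
  ring

lemma poissonEntropy_nonneg {k l : ℝ} (hk : 0 ≤ k) (hl : 0 ≤ l) (h : l = 0 → k = 0) :
    0 ≤ poissonEntropy k l := by
  rcases hl.eq_or_lt with rfl | hl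
  · simp [poissonEntropy, h rfl]
  · rw [poissonEntropy_eq_mul_klFun hl]
    exact mul_nonneg hl.le (klFun_nonneg (by positivity))

/-- The variational formula for the relative entropy of Poisson laws in terms of the mean. -/
lemma mul_log_div_le_poissonEntropy {k N p q : ℝ} (hk : 0 ≤ k) (hN : 0 ≤ N)
    (hp : 0 < p) (hq : 0 < q) (hkN : k ≤ N) :
    k * Real.log (q / p) ≤ poissonEntropy k (N * p) + (N * q - N * p) := by
  unfold poissonEntropy
  rcases hk.eq_or_lt with rfl | hk
  · simp; positivity
  · have hN : 0 < N := hk.trans_le hkN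
    have h1 : Real.log (q / p) = Real.log (k / (N * p)) + Real.log (N * q / k) := by
      rw [← Real.log_mul (by positivity) (by positivity)]
      congr 1
      field_simp
    have h2 : Real.log (N * q / k) ≤ N * q / k - 1 :=
      Real.log_le_sub_one_of_pos (by positivity)
    have h3 : k * Real.log (N * q / k) ≤ N * q - k := by
      calc k * Real.log (N * q / k) ≤ k * (N * q / k - 1) := by gcongr
        _ = N * q - k := by field_simp
    rw [h1, mul_add]
    linarith

lemma strictMonoOn_klFun : StrictMonoOn klFun (Set.Ici 1) := by
  refine strictMonoOn_of_deriv_pos (convex_Ici 1) continuous_klFun.continuousOn fun x hx => ?_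
  rw [interior_Ici, Set.mem_Ioi] at hx
  rw [deriv_klFun]
  exact Real.log_pos hx

lemma strictAntiOn_klFun : StrictAntiOn klFun (Set.Icc 0 1) := by
  refine strictAntiOn_of_deriv_neg (convex_Icc 0 1) continuous_klFun.continuousOn fun x hx => ?_
  rw [interior_Icc, Set.mem_Ioo] at hx
  rw [deriv_klFun]
  exact Real.log_neg hx.1 hx.2

lemma exists_one_le_klFun_eq {y : ℝ} (hy : 0 ≤ y) : ∃ u, 1 ≤ u ∧ klFun u = y := by
  obtain ⟨v, hv, hv1⟩ := ((tendsto_klFun_atTop.eventually_ge_atTop y).and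
    (Filter.eventually_ge_atTop 1)).exists
  obtain ⟨u, hu, h⟩ := intermediate_value_Icc hv1 continuous_klFun.continuousOn
    (show y ∈ Set.Icc (klFun 1) (klFun v) from ⟨by simpa [klFun_one] using hy, hv⟩)
  exact ⟨u, hu.1, h⟩

lemma exists_le_one_klFun_eq {y : ℝ} (hy : 0 ≤ y) (hy1 : y < 1) :
    ∃ u, 0 < u ∧ u ≤ 1 ∧ klFun u = y := by
  obtain ⟨u, hu, h⟩ := intermediate_value_Icc' zero_le_one continuous_klFun.continuousOn
    (show y ∈ Set.Icc (klFun 1) (klFun 0) from ⟨by simpa [klFun_one] using hy, by simpa [klFun_zero] using hy1.le⟩)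
  refine ⟨u, hu.1.lt_of_ne ?_, hu.2, h⟩
  rintro rfl
  rw [klFun_zero] at h
  linarith

/-! ### Mixtures over a finite grid of exponential parameters -/

/-- The weights of the mixtures of exponential families. -/
noncomputable def mixWeight {J : ℕ} (i : Fin J × Bool) : ℝ := (1 / 2) ^ ((i.1 : ℕ) + 2)

lemma mixWeight_nonneg {J : ℕ} (i : Fin J × Bool) : 0 ≤ mixWeight i := by
  unfold mixWeight; positivity

lemma sum_mixWeight_le_one (J : ℕ) : ∑ i : Fin J × Bool, mixWeight i ≤ 1 := by
  rw [Fintype.sum_prod_type]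
  simp only [mixWeight, Fintype.sum_bool]
  rw [Fin.sum_univ_eq_sum_range (fun j => (1 / 2 : ℝ) ^ (j + 2) + (1 / 2) ^ (j + 2))]
  have h : ∀ j : ℕ, (1 / 2 : ℝ) ^ (j + 2) + (1 / 2) ^ (j + 2) = (1 / 2) * (1 / 2) ^ j := by
    intro j; ring
  simp_rw [h]
  rw [← Finset.mul_sum]
  linarith [sum_geometric_two_le J]

/-- The weight costs a factor 2 per level while the exponent gains a factor `e`. Since `log 2 <
3/4`, a net growth of at least `exp (1/4)` per level remains, whence the 4 in `4 * K`. -/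
lemma mixWeight_mul_exp_ge {J : ℕ} (i : Fin J × Bool) {K E φ f : ℝ} (hK : 0 < K)
    (hφ : min φ E ≤ K * ((i.1 : ℕ) + 1)) (hf : ((i.1 : ℕ) : ℝ) ≤ f) :
    Real.exp (-1 / 4) / 4 * Real.exp (min φ E / (4 * K)) ≤ mixWeight i * Real.exp f := by
  obtain ⟨⟨j, hj⟩, s⟩ := i
  simp only [mixWeight] at *
  have h1 : min φ E / (4 * K) ≤ (j + 1) / 4 := by
    rw [div_le_div_iff₀ (by positivity) (by positivity)]
    linarith
  have h2 : Real.exp (-(3 / 4)) ≤ 1 / 2 := by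
    rw [← Real.le_log_iff_exp_le (by norm_num), one_div, Real.log_inv]
    have := Real.log_two_lt_d9
    linarith
  calc Real.exp (-1 / 4) / 4 * Real.exp (min φ E / (4 * K))
      ≤ Real.exp (-1 / 4) / 4 * Real.exp ((j + 1) / 4) := by gcongr
    _ = 1 / 4 * (Real.exp (-(3 / 4)) ^ j * Real.exp j) := by
        rw [← Real.exp_nat_mul, ← Real.exp_add, div_mul_eq_mul_div, ← Real.exp_add, one_div_mul_eq_div]
        congr 2
        ring
    _ ≤ 1 / 4 * ((1 / 2) ^ j * Real.exp f) := by gcongr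
    _ = (1 / 2) ^ (j + 2) * Real.exp f := by ring

/-- For a Poisson mean known up to the factor `K`, a mixture of exponential martingales over a
finite grid dominates an exponential of the maximal log-likelihood ratio, with constants that
depend only on `K`. -/
lemma exists_mixture_ge {K : ℝ} (hK : 0 < K) (E : ℝ) :
    ∃ J : ℕ, ∀ l₀ : ℝ, 0 ≤ l₀ → ∃ θ : Fin J × Bool → ℝ, ∀ l k : ℝ, 0 ≤ k → l₀ ≤ l → l ≤ K * l₀ →
      (l = 0 → k = 0) →
      Real.exp (-1 / 4) / 4 * Real.exp (min (poissonEntropy k l) E / (4 * K)) ≤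
        ∑ i, mixWeight i * Real.exp (θ i * k - l * (Real.exp (θ i) - 1)) := by
  refine ⟨⌈E / K⌉₊ + 1, fun l₀ hl₀ => ?_⟩
  -- One good grid point is enough, since all terms of the mixture are nonnegative.
  suffices h : ∃ θ : Fin (⌈E / K⌉₊ + 1) × Bool → ℝ, ∀ l k : ℝ, 0 ≤ k → l₀ ≤ l → l ≤ K * l₀ →
      (l = 0 → k = 0) → ∃ i : Fin (⌈E / K⌉₊ + 1) × Bool,
        min (poissonEntropy k l) E ≤ K * ((i.1 : ℕ) + 1) ∧
        ((i.1 : ℕ) : ℝ) ≤ θ i * k - l * (Real.exp (θ i) - 1) by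
    obtain ⟨θ, hθ⟩ := h
    refine ⟨θ, fun l k hk h1 h2 h3 => ?_⟩
    obtain ⟨i, hi1, hi2⟩ := hθ l k hk h1 h2 h3
    refine (mixWeight_mul_exp_ge i hK hi1 hi2).trans ?_
    exact Finset.single_le_sum (f := fun i => mixWeight i * Real.exp (θ i * k - l * (Real.exp (θ i) - 1)))
      (fun i _ => mul_nonneg (mixWeight_nonneg i) (Real.exp_pos _).le) (Finset.mem_univ i)
  rcases hl₀.eq_or_lt with rfl | hl₀
  · refine ⟨0, fun l k hk h1 h2 h3 => ⟨(0, true), ?_, ?_⟩⟩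
    · have hl : l = 0 := le_antisymm (by simpa using h2) h1
      refine (min_le_left _ _).trans ?_
      simp [poissonEntropy, hl, h3 hl, hK.le]
    · simp
  -- The grid puts level `j` where `l₀ * klFun` equals `j`, once above the mean (`u j`) and once
  -- below (`v j`). As `klFun ≤ 1` on `[0, 1]`, a positive `v j` is available for `j < l₀`;
  -- otherwise its value is a dummy.
  choose u hu1 hu2 using fun j : ℕ => exists_one_le_klFun_eq (y := j / l₀) (by positivity)
  have hv : ∀ j : ℕ, ∃ v : ℝ, (j : ℝ) < l₀ → 0 < v ∧ v ≤ 1 ∧ klFun v = j / l₀ := by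
    intro j
    by_cases h : (j : ℝ) < l₀
    · obtain ⟨v, hv⟩ := exists_le_one_klFun_eq (y := j / l₀) (by positivity)
        (by rwa [div_lt_one hl₀])
      exact ⟨v, fun _ => hv⟩
    · exact ⟨0, fun h' => absurd h' h⟩
  choose v hv using hv
  refine ⟨fun i => if i.2 then Real.log (u i.1) else Real.log (v i.1), fun l k hk h1 h2 h3 => ?_⟩
  have hl : 0 < l := hl₀.trans_le h1
  set y := k / l with hy
  have hy0 : 0 ≤ y := by positivity
  have hk' : k = l * y := by rw [hy]; field_simp
  have hkl : 0 ≤ klFun y := klFun_nonneg hy0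
  have hent : poissonEntropy k l ≤ K * (l₀ * klFun y) := by
    rw [poissonEntropy_eq_mul_klFun hl, ← mul_assoc]
    gcongr
  -- With `θ = log z` the exponent is affine in `y`, equals `l * klFun z` at `y = z`, and can only
  -- be larger when `y` is farther from 1 than `z` on the same side.
  have key : ∀ z : ℝ, 0 < z → ∀ j : ℕ, klFun z = j / l₀ → z * Real.log z ≤ y * Real.log z →
      (j : ℝ) ≤ Real.log z * k - l * (Real.exp (Real.log z) - 1) := by
    intro z hz j hj hzy
    rw [Real.exp_log hz]
    have hjz : (j : ℝ) = l₀ * klFun z := by rw [hj]; field_simp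
    calc (j : ℝ) = l₀ * klFun z := hjz
      _ ≤ l * klFun z := by gcongr; exact klFun_nonneg hz.le
      _ = l * (z * Real.log z + 1 - z) := rfl
      _ ≤ l * (y * Real.log z + 1 - z) := by gcongr
      _ = _ := by rw [hk']; ring
  -- Levels beyond the last one are replaced by the last, where the truncation at `E` takes over.
  have trunc : ∀ m : ℕ, l₀ * klFun y ≤ m + 1 →
      ∃ j : Fin (⌈E / K⌉₊ + 1), (j : ℕ) ≤ m ∧
        min (poissonEntropy k l) E ≤ K * ((j : ℕ) + 1) := by
    intro m hm
    rcases le_total m ⌈E / K⌉₊ with h | h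
    · exact ⟨⟨m, by omega⟩, le_rfl, (min_le_left _ _).trans (hent.trans (by gcongr))⟩
    · refine ⟨⟨⌈E / K⌉₊, by omega⟩, h, (min_le_right _ _).trans ?_⟩
      have := Nat.le_ceil (E / K)
      rw [div_le_iff₀ hK] at this
      nlinarith
  rcases le_total 1 y with hy1 | hy1
  · obtain ⟨j, hjm, hj⟩ := trunc ⌊l₀ * klFun y⌋₊ (Nat.lt_floor_add_one _).le
    refine ⟨(j, true), hj, ?_⟩
    have hle : ((j : ℕ) : ℝ) ≤ l₀ * klFun y :=
      le_trans (by exact_mod_cast hjm) (Nat.floor_le (by positivity))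
    simp only [if_true]
    have hj1 := hu1 j
    refine key (u j) (by linarith) j (hu2 j) ?_
    have : u j ≤ y := by
      rw [← strictMonoOn_klFun.le_iff_le (hu1 j) hy1, hu2, div_le_iff₀ hl₀]
      linarith
    exact mul_le_mul_of_nonneg_right this (Real.log_nonneg hj1)
  · rcases hkl.eq_or_lt with h0 | h0
    · obtain ⟨j, hjm, hj⟩ := trunc 0 (by rw [← h0]; simp)
      refine ⟨(j, false), hj, ?_⟩
      have hj0 : (j : ℕ) = 0 := by omega
      obtain ⟨hv1, hv2, hv3⟩ := hv 0 (by simpa using hl₀)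
      simp only [Bool.false_eq_true, if_false, hj0]
      refine key (v 0) hv1 0 hv3 ?_
      have h1 : v 0 = 1 := by
        rw [← klFun_eq_zero_iff hv1.le, hv3]; simp
      simp [h1]
    · have hpos : 0 < l₀ * klFun y := by positivity
      have hceil := Nat.ceil_pos.2 hpos
      -- Ceiling minus one rather than floor makes `j < l₀ * klFun y ≤ l₀` strict, as the existence
      -- of `v j` requires.
      obtain ⟨j, hjm, hj⟩ := trunc (⌈l₀ * klFun y⌉₊ - 1) (by
        rw [Nat.cast_sub hceil, Nat.cast_one, sub_add_cancel]
        exact Nat.le_ceil _)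
      refine ⟨(j, false), hj, ?_⟩
      have hle : ((j : ℕ) : ℝ) < l₀ * klFun y := by
        rw [← Nat.lt_ceil]; omega
      have hy1' : klFun y ≤ 1 := by
        rw [← klFun_zero]
        exact strictAntiOn_klFun.antitoneOn ⟨le_rfl, zero_le_one⟩ ⟨hy0, hy1⟩ hy0
      obtain ⟨hv1, hv2, hv3⟩ := hv j (hle.trans_le (by nlinarith))
      simp only [Bool.false_eq_true, if_false]
      refine key (v j) hv1 j hv3 ?_
      have : y ≤ v j := by
        rw [← strictAntiOn_klFun.le_iff_ge ⟨hv1.le, hv2⟩ ⟨hy0, hy1⟩, hv3, div_le_iff₀ hl₀]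
        linarith
      exact mul_le_mul_of_nonpos_right this (Real.log_nonpos hv1.le hv2)

end MarkovOrder

namespace MarkovOrder

open Finset

variable {A : Type*}

/-! ### Prefixes and blocks of paths -/

lemma mem_prefixEvent {n : ℕ} {x y : ℕ → A} : y ∈ prefixEvent n x ↔ ∀ i < n, y i = x i := by
  simp only [prefixEvent, blockEvent, block, Set.mem_ofPred_eq, funext_iff, zero_add]
  exact ⟨fun h i hi => h ⟨i, hi⟩, fun h i => h i i.2⟩

lemma prefixEvent_anti {m n : ℕ} (h : m ≤ n) (x : ℕ → A) : prefixEvent n x ⊆ prefixEvent m x :=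
  fun _ hy => mem_prefixEvent.2 fun i hi => mem_prefixEvent.1 hy i (hi.trans_le h)

lemma prefixEvent_congr {n : ℕ} {x y : ℕ → A} (h : ∀ i < n, x i = y i) :
    prefixEvent n x = prefixEvent n y := by
  ext z
  simp only [mem_prefixEvent]
  exact forall₂_congr fun i hi => by rw [h i hi]

lemma block_congr {m r : ℕ} {x y : ℕ → A} (h : ∀ i < m + r, x i = y i) :
    block m r x = block m r y :=
  funext fun j => h _ (by omega)

lemma measurableSet_blockEvent [Finite A] [MeasurableSpace A] [MeasurableSingletonClass A]
    (m : ℕ) {r : ℕ} (a : Fin r → A) : MeasurableSet (blockEvent m a) := by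
  have h : Measurable (fun x : ℕ → A => block m r x) :=
    measurable_pi_iff.2 fun j => measurable_pi_apply _
  exact h (measurableSet_singleton a)

lemma sum_measureReal_blockEvent [Fintype A] [MeasurableSpace A] [MeasurableSingletonClass A]
    (P : Measure (ℕ → A)) [IsProbabilityMeasure P] (r : ℕ) :
    ∑ a : Fin r → A, P.real (blockEvent 0 a) = 1 := by
  classical
  have := sum_measureReal_preimage_singleton (μ := P) (Finset.univ : Finset (Fin r → A))
    (f := block 0 r) (fun a _ => measurableSet_blockEvent 0 a)
  simp only [Finset.coe_univ, Set.preimage_univ, probReal_univ] at this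
  exact this

lemma measure_prefixEvent_eq_zero [Finite A] [MeasurableSpace A] (P : Measure (ℕ → A)) (N : ℕ) :
    P {x | P (prefixEvent N x) = 0} = 0 := by
  refine measure_mono_null (t := ⋃ a : {a : Fin N → A // P (blockEvent 0 a) = 0},
    blockEvent 0 a.1) ?_ (measure_iUnion_null fun a => a.2)
  intro x hx
  exact Set.mem_iUnion.2 ⟨⟨block 0 N x, hx⟩, rfl⟩

lemma IsStationary.measure_blockEvent [Finite A] [MeasurableSpace A] [MeasurableSingletonClass A]
    {P : Measure (ℕ → A)} (hP : IsStationary P) (m : ℕ) {r : ℕ} (a : Fin r → A) :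
    P (blockEvent m a) = P (blockEvent 0 a) := by
  induction m with
  | zero => rfl
  | succ m ih =>
    rw [← ih, ← hP.measure_preimage (measurableSet_blockEvent m a).nullMeasurableSet]
    congr 1
    ext x
    have : block (m + 1) r x = block m r fun i => x (i + 1) :=
      funext fun j => congrArg x (by omega)
    simp only [blockEvent, Set.mem_ofPred_eq, Set.mem_preimage, this]

/-! ### The classes of Markov chains -/

lemma markovClass_mono [Fintype A] [MeasurableSpace A] {s r : ℕ} (h : s ≤ r) :
    markovClass A s ⊆ markovClass A r := by
  rintro P ⟨hP, p, hp0, hp1, hp⟩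
  obtain ⟨d, rfl⟩ := Nat.exists_eq_add_of_le' h
  -- The offset `d` keeps the last `s` letters of the longer word.
  refine ⟨hP, fun a => p fun j => a ⟨d + j, by omega⟩, fun a b => hp0 _ _, fun a => hp1 _, ?_⟩
  intro n x
  have e1 : d + s + n = s + (d + n) := by ring
  have e2 : d + s = s + d := by ring
  rw [e1, hp, Finset.prod_range_add, ← mul_assoc, ← hp, ← e2]
  congr 1
  refine Finset.prod_congr rfl fun i _ => ?_
  congr 1
  · funext j
    simp only [block]
    congr 1
    omega
  · congr 1
    omega

/-- The law `P` is that of a Markov chain of order at most `r` with transition probability `p`. -/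
structure HasTransition [Fintype A] [MeasurableSpace A] (P : Measure (ℕ → A)) (r : ℕ)
    (p : (Fin r → A) → A → ℝ) : Prop where
  nonneg : ∀ a b, 0 ≤ p a b
  sum_eq_one : ∀ a, ∑ b, p a b = 1
  real_prefixEvent : ∀ (n : ℕ) (x : ℕ → A), P.real (prefixEvent (r + n) x) =
    P.real (prefixEvent r x) * ∏ i ∈ Finset.range n, p (block i r x) (x (i + r))

lemma HasTransition.real_prefixEvent_succ [Fintype A] [MeasurableSpace A] {P : Measure (ℕ → A)}
    {r : ℕ} {p : (Fin r → A) → A → ℝ} (h : HasTransition P r p) (n : ℕ) (x : ℕ → A) :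
    P.real (prefixEvent (r + (n + 1)) x) =
      P.real (prefixEvent (r + n) x) * p (block n r x) (x (n + r)) := by
  rw [h.real_prefixEvent, h.real_prefixEvent, Finset.prod_range_succ, mul_assoc]

/-! ### A maximal inequality -/

/-- A process adapted to the letters of the path, indexed from the `r`-th letter on, that is a
nonnegative supermartingale under `P`. -/
structure IsSupermartingale [Fintype A] [DecidableEq A] [MeasurableSpace A]
    (P : Measure (ℕ → A)) (r : ℕ) (W : ℕ → (ℕ → A) → ℝ) : Prop where
  nonneg : ∀ n x, 0 ≤ W n x
  congr : ∀ n x y, (∀ i < r + n, x i = y i) → W n x = W n y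
  sum_le : ∀ n x, ∑ b, P.real (prefixEvent (r + (n + 1)) (Function.update x (r + n) b)) *
    W (n + 1) (Function.update x (r + n) b) ≤ P.real (prefixEvent (r + n) x) * W n x

section Supermartingale

variable [Fintype A] [DecidableEq A] [MeasurableSpace A] {P : Measure (ℕ → A)}
  {r : ℕ}

lemma IsSupermartingale.sum {ι : Type*} [Fintype ι] {w : ι → ℝ} (hw : ∀ i, 0 ≤ w i)
    {W : ι → ℕ → (ℕ → A) → ℝ} (h : ∀ i, IsSupermartingale P r (W i)) :
    IsSupermartingale P r fun n x => ∑ i, w i * W i n x where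
  nonneg n x := Finset.sum_nonneg fun i _ => mul_nonneg (hw i) ((h i).nonneg n x)
  congr n x y hxy := Finset.sum_congr rfl fun i _ => by rw [(h i).congr n x y hxy]
  sum_le n x := by
    simp_rw [Finset.mul_sum]
    rw [Finset.sum_comm]
    refine Finset.sum_le_sum fun i _ => ?_
    calc _ = w i * ∑ b, P.real (prefixEvent (r + (n + 1)) (Function.update x (r + n) b)) *
          W i (n + 1) (Function.update x (r + n) b) := by
          rw [Finset.mul_sum]
          exact Finset.sum_congr rfl fun b _ => by ring
      _ ≤ w i * (P.real (prefixEvent (r + n) x) * W i n x) := by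
          gcongr
          · exact hw i
          · exact (h i).sum_le n x
      _ = _ := by ring

variable [IsProbabilityMeasure P]

/-- Induction on the remaining time `d`: either `W` has already reached `t` at this prefix, or the
crossing occurs after one of its one-letter extensions, and `sum_le` adds up their bounds. -/
lemma IsSupermartingale.real_prefixEvent_inter_mul_le {W : ℕ → (ℕ → A) → ℝ}
    (h : IsSupermartingale P r W) {t : ℝ} (ht : 0 < t) (d n : ℕ) (x : ℕ → A) :
    P.real (prefixEvent (r + n) x ∩ {y | ∃ m, n ≤ m ∧ m ≤ n + d ∧ t ≤ W m y}) * t ≤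
      P.real (prefixEvent (r + n) x) * W n x := by
  induction d generalizing n x with
  | zero =>
    by_cases htW : t ≤ W n x
    · exact mul_le_mul (measureReal_mono Set.inter_subset_left) htW ht.le measureReal_nonneg
    · have : prefixEvent (r + n) x ∩ {y | ∃ m, n ≤ m ∧ m ≤ n + 0 ∧ t ≤ W m y} = ∅ := by
        refine Set.eq_empty_of_forall_notMem ?_
        rintro y ⟨hy, m, hm1, hm2, hm3⟩
        obtain rfl : m = n := by omega
        rw [h.congr m y x (mem_prefixEvent.1 hy)] at hm3
        exact htW hm3
      rw [this]
      simpa using mul_nonneg measureReal_nonneg (h.nonneg n x)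
  | succ d ih =>
    by_cases htW : t ≤ W n x
    · exact mul_le_mul (measureReal_mono Set.inter_subset_left) htW ht.le measureReal_nonneg
    · have hsub : prefixEvent (r + n) x ∩ {y | ∃ m, n ≤ m ∧ m ≤ n + (d + 1) ∧ t ≤ W m y} ⊆
          ⋃ b, prefixEvent (r + (n + 1)) (Function.update x (r + n) b) ∩
            {y | ∃ m, n + 1 ≤ m ∧ m ≤ n + 1 + d ∧ t ≤ W m y} := by
        rintro y ⟨hy, m, hm1, hm2, hm3⟩
        rw [mem_prefixEvent] at hy
        refine Set.mem_iUnion.2 ⟨y (r + n), mem_prefixEvent.2 fun i hi => ?_, m, ?_, by omega, hm3⟩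
        · rcases eq_or_ne i (r + n) with rfl | hne
          · simp
          · rw [Function.update_of_ne hne]
            exact hy i (by omega)
        · rcases hm1.eq_or_lt with rfl | hlt
          · rw [h.congr n y x hy] at hm3
            exact absurd hm3 htW
          · exact hlt
      calc _ ≤ (∑ b, P.real (prefixEvent (r + (n + 1)) (Function.update x (r + n) b) ∩
            {y | ∃ m, n + 1 ≤ m ∧ m ≤ n + 1 + d ∧ t ≤ W m y})) * t := by
            gcongr
            exact (measureReal_mono hsub).trans (measureReal_iUnion_fintype_le _)
        _ ≤ _ := by
            rw [Finset.sum_mul]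
            exact (Finset.sum_le_sum fun b _ => ih (n + 1) _).trans (h.sum_le n x)

lemma IsSupermartingale.real_exists_ge_le [MeasurableSingletonClass A] {W : ℕ → (ℕ → A) → ℝ}
    (h : IsSupermartingale P r W) (h0 : ∀ x, W 0 x ≤ 1) {t : ℝ} (ht : 0 < t) (N : ℕ) :
    P.real {y | ∃ m, m ≤ N ∧ t ≤ W m y} ≤ t⁻¹ := by
  rw [← one_div, le_div_iff₀ ht]
  obtain ⟨z⟩ : Nonempty (ℕ → A) := P.nonempty_of_neZero
  -- Any continuation of the word would do; `z` only fills the remaining letters.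
  let e : (Fin r → A) → ℕ → A := fun a i => if hi : i < r then a ⟨i, hi⟩ else z i
  have he : ∀ a, prefixEvent (r + 0) (e a) = blockEvent 0 a := by
    intro a
    have : block 0 r (e a) = a := by
      funext j
      simp [block, e]
    simp [prefixEvent, this]
  have hsub : {y | ∃ m, m ≤ N ∧ t ≤ W m y} ⊆ ⋃ a : Fin r → A, prefixEvent (r + 0) (e a) ∩
      {y | ∃ m, 0 ≤ m ∧ m ≤ 0 + N ∧ t ≤ W m y} := by
    rintro y ⟨m, hm, hy⟩
    refine Set.mem_iUnion.2 ⟨block 0 r y, ?_, m, zero_le, by omega, hy⟩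
    rw [he]
    rfl
  calc _ ≤ (∑ a : Fin r → A, P.real (prefixEvent (r + 0) (e a) ∩
          {y | ∃ m, 0 ≤ m ∧ m ≤ 0 + N ∧ t ≤ W m y})) * t := by
        gcongr
        exact (measureReal_mono hsub).trans (measureReal_iUnion_fintype_le _)
    _ ≤ ∑ a : Fin r → A, P.real (prefixEvent (r + 0) (e a)) := by
        rw [Finset.sum_mul]
        exact Finset.sum_le_sum fun a _ => (h.real_prefixEvent_inter_mul_le ht N 0 (e a)).trans
          (mul_le_of_le_one_right measureReal_nonneg (h0 _))
    _ = 1 := by simp_rw [he]; exact sum_measureReal_blockEvent P r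

end Supermartingale

/-! ### Exponential supermartingales of Markov chains -/

/-- The exponential process with parameters `θ` of a Markov chain of order at most `r`. -/
noncomputable def expMartingale [Fintype A] {r : ℕ} (p : (Fin r → A) → A → ℝ)
    (θ : (Fin r → A) × A → ℝ) (n : ℕ) (x : ℕ → A) : ℝ :=
  ∏ j ∈ range n, Real.exp (θ (block j r x, x (j + r)) -
    ∑ b, p (block j r x) b * (Real.exp (θ (block j r x, b)) - 1))

lemma HasTransition.isSupermartingale_expMartingale [Fintype A] [DecidableEq A] [MeasurableSpace A]
    {P : Measure (ℕ → A)} {r : ℕ} {p : (Fin r → A) → A → ℝ} (h : HasTransition P r p)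
    (θ : (Fin r → A) × A → ℝ) : IsSupermartingale P r (expMartingale p θ) := by
  have hcongr : ∀ n (x y : ℕ → A), (∀ i < r + n, x i = y i) →
      expMartingale p θ n x = expMartingale p θ n y := by
    intro n x y hxy
    refine Finset.prod_congr rfl fun j hj => ?_
    rw [Finset.mem_range] at hj
    rw [block_congr (m := j) (r := r) (x := x) (y := y) fun i hi => hxy i (by omega),
      hxy (j + r) (by omega)]
  refine ⟨fun n x => Finset.prod_nonneg fun _ _ => (Real.exp_pos _).le, hcongr, fun n x => ?_⟩
  set a := block n r x with ha
  have hup : ∀ b, ∀ i < r + n, Function.update x (r + n) b i = x i := fun b i hi =>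
    Function.update_of_ne hi.ne _ _
  have hterm : ∀ b, P.real (prefixEvent (r + (n + 1)) (Function.update x (r + n) b)) *
      expMartingale p θ (n + 1) (Function.update x (r + n) b) =
      P.real (prefixEvent (r + n) x) * expMartingale p θ n x *
        (p a b * Real.exp (θ (a, b)) *
          Real.exp (-∑ b', p a b' * (Real.exp (θ (a, b')) - 1))) := by
    intro b
    have hbl : block n r (Function.update x (r + n) b) = a :=
      block_congr fun i hi => hup b i (by omega)
    have hb : Function.update x (r + n) b (n + r) = b := by
      rw [add_comm n r, Function.update_self]
    rw [h.real_prefixEvent_succ, expMartingale, Finset.prod_range_succ, hbl, hb,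
      prefixEvent_congr (hup b), sub_eq_add_neg, Real.exp_add]
    have := hcongr n _ _ (hup b)
    rw [expMartingale] at this
    rw [this]
    ring
  simp_rw [hterm]
  rw [← Finset.mul_sum, ← Finset.sum_mul]
  refine mul_le_of_le_one_right (mul_nonneg measureReal_nonneg
    (Finset.prod_nonneg fun _ _ => (Real.exp_pos _).le)) ?_
  rw [Real.exp_neg, ← div_eq_mul_inv, div_le_one (Real.exp_pos _)]
  have : ∑ b, p a b * Real.exp (θ (a, b)) = ∑ b, p a b * (Real.exp (θ (a, b)) - 1) + 1 := by
    simp_rw [mul_sub, Finset.sum_sub_distrib, mul_one, h.sum_eq_one]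
    ring
  rw [this]
  -- The one-step mean of `exp θ` is `1 + ∑ p (exp θ - 1)`; compensating by the exponential of the
  -- sum loses a little, so the process is a supermartingale, but lets the letters factor.
  exact Real.add_one_le_exp _

/-! ### Counting transitions -/

open Classical in
/-- The number of occurrences of the word `a` among the first `n` blocks of its length. -/
noncomputable def wordCount {r : ℕ} (n : ℕ) (a : Fin r → A) (x : ℕ → A) : ℕ :=
  #{j ∈ range n | block j r x = a}

open Classical in
/-- The number of transitions from the word `a.1` to the letter `a.2` among the first `n`. -/
noncomputable def transCount {r : ℕ} (n : ℕ) (a : (Fin r → A) × A) (x : ℕ → A) : ℕ :=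
  #{j ∈ range n | (block j r x, x (j + r)) = a}

lemma wordCount_mono {r : ℕ} (a : Fin r → A) (x : ℕ → A) :
    Monotone fun n => wordCount n a x := by
  classical
  exact fun m n h => Finset.card_le_card (Finset.filter_subset_filter _ (Finset.range_mono h))

lemma transCount_le_wordCount {r : ℕ} (n : ℕ) (a : (Fin r → A) × A) (x : ℕ → A) :
    transCount n a x ≤ wordCount n a.1 x := by
  refine Finset.card_le_card fun j hj => ?_
  simp only [Finset.mem_filter] at hj ⊢
  exact ⟨hj.1, congrArg Prod.fst hj.2⟩

lemma blockCount_eq_wordCount {r n : ℕ} (h : r ≤ n) (a : Fin r → A) (x : ℕ → A) :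
    blockCount n a x = wordCount (n - r) a x := by
  obtain ⟨m, rfl⟩ := Nat.exists_eq_add_of_le h
  rw [blockCount, wordCount, Finset.card_filter, Nat.add_sub_cancel_left]
  refine (Finset.sum_bij (fun j _ => j + r + 1) ?_ ?_ ?_ ?_).symm
  · intro j hj
    simp only [Finset.mem_range, Finset.mem_Icc] at hj ⊢
    omega
  · intro i _ j _ hij
    omega
  · intro i hi
    simp only [Finset.mem_Icc] at hi
    exact ⟨i - r - 1, Finset.mem_range.2 (by omega), by omega⟩
  · intro j _
    have : j + r + 1 - r - 1 = j := by omega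
    rw [this]

lemma sum_wordCount_mul [Fintype A] {r : ℕ} (n : ℕ) (x : ℕ → A) (g : (Fin r → A) → ℝ) :
    ∑ j ∈ range n, g (block j r x) = ∑ a, wordCount n a x * g a := by
  classical
  rw [← Finset.sum_fiberwise (range n) (fun j => block j r x)]
  refine Finset.sum_congr rfl fun a _ => ?_
  rw [Finset.sum_congr rfl (g := fun _ => g a) fun j hj => by rw [(Finset.mem_filter.1 hj).2],
    Finset.sum_const, nsmul_eq_mul, wordCount]

lemma sum_transCount_mul [Fintype A] {r : ℕ} (n : ℕ) (x : ℕ → A) (g : (Fin r → A) × A → ℝ) :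
    ∑ j ∈ range n, g (block j r x, x (j + r)) = ∑ a, transCount n a x * g a := by
  classical
  rw [← Finset.sum_fiberwise (range n) (fun j => (block j r x, x (j + r)))]
  refine Finset.sum_congr rfl fun a _ => ?_
  rw [Finset.sum_congr rfl (g := fun _ => g a) fun j hj => by rw [(Finset.mem_filter.1 hj).2],
    Finset.sum_const, nsmul_eq_mul, transCount]

/-- Regrouping time steps by transition separates the pairs, so that each parameter can be mixed
independently. -/
lemma expMartingale_eq_prod [Fintype A] {r : ℕ} (p : (Fin r → A) → A → ℝ)
    (θ : (Fin r → A) × A → ℝ) (n : ℕ) (x : ℕ → A) :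
    expMartingale p θ n x = ∏ a : (Fin r → A) × A, Real.exp (θ a * transCount n a x -
      wordCount n a.1 x * p a.1 a.2 * (Real.exp (θ a) - 1)) := by
  rw [expMartingale, ← Real.exp_sum, ← Real.exp_sum, Finset.sum_sub_distrib, Finset.sum_sub_distrib,
    sum_transCount_mul, sum_wordCount_mul n x fun a => ∑ b, p a b * (Real.exp (θ (a, b)) - 1),
    Fintype.sum_prod_type (f := fun a : (Fin r → A) × A =>
      (wordCount n a.1 x : ℝ) * p a.1 a.2 * (Real.exp (θ a) - 1))]
  simp_rw [Finset.mul_sum, mul_assoc, mul_comm]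

/-- The mixture of the exponential processes with product weights. -/
noncomputable def mixMartingale [Fintype A] {r : ℕ} (p : (Fin r → A) → A → ℝ) {J : ℕ}
    (θ : (Fin r → A) × A → Fin J × Bool → ℝ) (n : ℕ) (x : ℕ → A) : ℝ :=
  ∏ a : (Fin r → A) × A, ∑ i, mixWeight i * Real.exp (θ a i * transCount n a x -
      wordCount n a.1 x * p a.1 a.2 * (Real.exp (θ a i) - 1))

lemma HasTransition.isSupermartingale_mixMartingale [Fintype A] [DecidableEq A] [MeasurableSpace A]
    {P : Measure (ℕ → A)} {r : ℕ} {p : (Fin r → A) → A → ℝ} (h : HasTransition P r p) {J : ℕ}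
    (θ : (Fin r → A) × A → Fin J × Bool → ℝ) : IsSupermartingale P r (mixMartingale p θ) := by
  have := IsSupermartingale.sum (P := P) (r := r)
    (ι := (Fin r → A) × A → Fin J × Bool) (w := fun σ => ∏ a, mixWeight (σ a))
    (fun σ => Finset.prod_nonneg fun a _ => mixWeight_nonneg _)
    fun σ => h.isSupermartingale_expMartingale fun a => θ a (σ a)
  convert this using 3 with n x
  -- The product of mixtures is one mixture over all choices `σ` of a grid point for each pair.
  rw [mixMartingale, Finset.prod_univ_sum, Fintype.piFinset_univ]
  refine Finset.sum_congr rfl fun σ _ => ?_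
  rw [expMartingale_eq_prod, Finset.prod_mul_distrib]

lemma mixMartingale_zero_le_one [Fintype A] {r : ℕ} (p : (Fin r → A) → A → ℝ) {J : ℕ}
    (θ : (Fin r → A) × A → Fin J × Bool → ℝ) (x : ℕ → A) : mixMartingale p θ 0 x ≤ 1 := by
  refine Finset.prod_le_one (fun a _ => Finset.sum_nonneg fun i _ =>
    mul_nonneg (mixWeight_nonneg _) (Real.exp_pos _).le) fun a _ => ?_
  simpa [transCount, wordCount] using sum_mixWeight_le_one J

/-- If all entries are nonnegative then truncating them at `E` keeps the sum above `E`. -/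
lemma le_sum_min {ι : Type*} [Fintype ι] {f : ι → ℝ} (hf : ∀ i, 0 ≤ f i) {E : ℝ} (hE : 0 ≤ E)
    (h : E ≤ ∑ i, f i) : E ≤ ∑ i, min (f i) E := by
  by_cases hi : ∃ i, E ≤ f i
  · obtain ⟨i, hi⟩ := hi
    calc E = min (f i) E := (min_eq_right hi).symm
      _ ≤ _ := Finset.single_le_sum (f := fun i => min (f i) E)
        (fun j _ => le_min (hf j) hE) (Finset.mem_univ i)
  · push Not at hi
    rwa [Finset.sum_congr rfl fun i _ => min_eq_left (hi i).le]

end MarkovOrder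

namespace MarkovOrder

open Finset

variable {A : Type*} [Fintype A] [MeasurableSpace A] {P : Measure (ℕ → A)} {r : ℕ}
  {p : (Fin r → A) → A → ℝ}

/-! ### Likelihood ratios and transition counts -/

lemma HasTransition.apply_pos [IsProbabilityMeasure P] (h : HasTransition P r p) {m : ℕ}
    {x : ℕ → A} (hx : 0 < P.real (prefixEvent (r + m) x)) {j : ℕ} (hj : j < m) :
    0 < p (block j r x) (x (j + r)) := by
  refine (h.nonneg _ _).lt_of_ne fun h0 => hx.ne' ?_
  rw [h.real_prefixEvent, Finset.prod_eq_zero (Finset.mem_range.2 hj) h0.symm, mul_zero]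

lemma HasTransition.transCount_eq_zero [IsProbabilityMeasure P] (h : HasTransition P r p)
    {m : ℕ} {x : ℕ → A} (hx : 0 < P.real (prefixEvent (r + m) x)) {a : (Fin r → A) × A}
    (ha : p a.1 a.2 = 0) : transCount m a x = 0 := by
  classical
  refine Finset.card_eq_zero.2 (Finset.filter_eq_empty_iff.2 fun j hj hja => ?_)
  have := h.apply_pos hx (Finset.mem_range.1 hj)
  rw [← hja] at ha
  exact this.ne' ha

lemma HasTransition.eq_zero_of_mul_eq_zero [IsProbabilityMeasure P] (h : HasTransition P r p)
    {m : ℕ} {x : ℕ → A} (hx : 0 < P.real (prefixEvent (r + m) x)) {a : (Fin r → A) × A}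
    (ha : (wordCount m a.1 x : ℝ) * p a.1 a.2 = 0) : (transCount m a x : ℝ) = 0 := by
  rcases mul_eq_zero.1 ha with h0 | h0
  · have h0 : wordCount m a.1 x = 0 := by exact_mod_cast h0
    have := transCount_le_wordCount m a x
    exact_mod_cast Nat.le_zero.1 (h0 ▸ this)
  · exact_mod_cast h.transCount_eq_zero hx h0

lemma HasTransition.poissonEntropy_nonneg [IsProbabilityMeasure P] (h : HasTransition P r p)
    {m : ℕ} {x : ℕ → A} (hx : 0 < P.real (prefixEvent (r + m) x)) (a : (Fin r → A) × A) :
    0 ≤ poissonEntropy (transCount m a x) (wordCount m a.1 x * p a.1 a.2) :=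
  MarkovOrder.poissonEntropy_nonneg (Nat.cast_nonneg _)
    (mul_nonneg (Nat.cast_nonneg _) (h.nonneg _ _)) (h.eq_zero_of_mul_eq_zero hx)

/-- Along a path of positive probability, no Markov chain of the same order beats the true
transition probabilities by more than the total relative entropy. -/
lemma HasTransition.log_prod_le [IsProbabilityMeasure P] (h : HasTransition P r p)
    {m : ℕ} {x : ℕ → A} (hx : 0 < P.real (prefixEvent (r + m) x))
    {q : (Fin r → A) → A → ℝ} (hq0 : ∀ a b, 0 ≤ q a b) (hq1 : ∀ a, ∑ b, q a b = 1)
    (hq : 0 < ∏ j ∈ range m, q (block j r x) (x (j + r))) :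
    Real.log (∏ j ∈ range m, q (block j r x) (x (j + r))) ≤
      Real.log (∏ j ∈ range m, p (block j r x) (x (j + r))) +
      ∑ a : (Fin r → A) × A,
        poissonEntropy (transCount m a x) (wordCount m a.1 x * p a.1 a.2) := by
  have hq' : ∀ j ∈ range m, 0 < q (block j r x) (x (j + r)) := fun j hj =>
    (hq0 _ _).lt_of_ne fun h0 => hq.ne' (Finset.prod_eq_zero hj h0.symm)
  have hp' : ∀ j ∈ range m, 0 < p (block j r x) (x (j + r)) := fun j hj =>
    h.apply_pos hx (Finset.mem_range.1 hj)
  rw [Real.log_prod fun j hj => (hq' j hj).ne', Real.log_prod fun j hj => (hp' j hj).ne',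
    ← sub_le_iff_le_add', ← Finset.sum_sub_distrib]
  have hlog : ∑ j ∈ range m, (Real.log (q (block j r x) (x (j + r))) -
      Real.log (p (block j r x) (x (j + r)))) =
      ∑ a : (Fin r → A) × A, transCount m a x * Real.log (q a.1 a.2 / p a.1 a.2) := by
    rw [← sum_transCount_mul m x fun a => Real.log (q a.1 a.2 / p a.1 a.2)]
    exact Finset.sum_congr rfl fun j hj => (Real.log_div (hq' j hj).ne' (hp' j hj).ne').symm
  -- The mean corrections of the variational formula cancel, since `p` and `q` both sum to 1 over
  -- the letter.
  have hmass : ∑ a : (Fin r → A) × A, ((wordCount m a.1 x : ℝ) * q a.1 a.2 -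
      wordCount m a.1 x * p a.1 a.2) = 0 := by
    rw [Fintype.sum_prod_type]
    refine Finset.sum_eq_zero fun a _ => ?_
    simp only
    rw [Finset.sum_sub_distrib, ← Finset.mul_sum, ← Finset.mul_sum, hq1, h.sum_eq_one, sub_self]
  rw [hlog, ← add_zero (∑ a : (Fin r → A) × A, poissonEntropy _ _), ← hmass,
    ← Finset.sum_add_distrib]
  refine Finset.sum_le_sum fun a _ => ?_
  rcases Nat.eq_zero_or_pos (transCount m a x) with h0 | hpos
  · have h1 : 0 ≤ (wordCount m a.1 x : ℝ) * q a.1 a.2 :=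
      mul_nonneg (Nat.cast_nonneg _) (hq0 _ _)
    simp [h0, poissonEntropy, h1]
  · classical
    obtain ⟨j, hj⟩ := Finset.card_pos.1 hpos
    rw [Finset.mem_filter] at hj
    have hpa := hp' j hj.1
    have hqa := hq' j hj.1
    obtain ⟨hj1, rfl⟩ := hj
    exact mul_log_div_le_poissonEntropy (Nat.cast_nonneg _) (Nat.cast_nonneg _) hpa hqa
      (by exact_mod_cast transCount_le_wordCount m _ x)

lemma HasTransition.condLogLik_eq [MeasurableSingletonClass A] [IsProbabilityMeasure P]
    (h : HasTransition P r p) {m : ℕ} {x : ℕ → A} (hx : 0 < P.real (prefixEvent (r + m) x)) :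
    condLogLik P r (r + m) x =
      (Real.log (∏ j ∈ range m, p (block j r x) (x (j + r))) : ℝ) := by
  have hr : 0 < P.real (prefixEvent r x) :=
    hx.trans_le (measureReal_mono (prefixEvent_anti (by omega) x))
  have hprod : 0 < ∏ j ∈ range m, p (block j r x) (x (j + r)) :=
    Finset.prod_pos fun j hj => h.apply_pos hx (Finset.mem_range.1 hj)
  rw [condLogLik, ProbabilityTheory.cond_apply
      (show MeasurableSet (prefixEvent r x) from measurableSet_blockEvent 0 _),
    Set.inter_eq_right.2 (prefixEvent_anti (by omega) x), ← ENNReal.log_ofReal_of_pos hprod]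
  congr 1
  rw [← ofReal_measureReal (μ := P) (s := prefixEvent r x),
    ← ofReal_measureReal (μ := P) (s := prefixEvent (r + m) x), ← ENNReal.ofReal_inv_of_pos hr,
    ← ENNReal.ofReal_mul (by positivity), h.real_prefixEvent, inv_mul_cancel_left₀ hr.ne']

lemma HasTransition.maxLogLik_sub_condLogLik_le [MeasurableSingletonClass A]
    [IsProbabilityMeasure P] (h : HasTransition P r p) {m : ℕ} {x : ℕ → A}
    (hx : 0 < P.real (prefixEvent (r + m) x)) :
    maxLogLik r (r + m) x - condLogLik P r (r + m) x ≤
      (∑ a : (Fin r → A) × A,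
        poissonEntropy (transCount m a x) (wordCount m a.1 x * p a.1 a.2) : ℝ) := by
  rw [h.condLogLik_eq hx]
  refine EReal.sub_le_of_le_add' ?_
  rw [← EReal.coe_add]
  refine iSup₂_le ?_
  rintro Q ⟨hQ, q, hq0, hq1, hq⟩
  rcases eq_or_ne (Q (prefixEvent (r + m) x)) 0 with h0 | h0
  · simp [h0]
  have hpos : 0 < Q.real (prefixEvent (r + m) x) :=
    ENNReal.toReal_pos h0 (measure_ne_top _ _)
  -- The competitor's initial law contributes a factor at most 1; on the true side it is removed by
  -- the conditioning.
  have hle : Q.real (prefixEvent (r + m) x) ≤ ∏ j ∈ range m, q (block j r x) (x (j + r)) := by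
    rw [hq]
    exact mul_le_of_le_one_left (Finset.prod_nonneg fun _ _ => hq0 _ _) measureReal_le_one
  rw [← ofReal_measureReal, ENNReal.log_ofReal_of_pos hpos, EReal.coe_le_coe_iff]
  exact (Real.log_le_log hpos hle).trans (h.log_prod_le hx hq0 hq1 (hpos.trans_le hle))

/-! ### The deviation bound on the typical event -/

/-- On the typical event, the expected transition counts are known up to a constant factor. -/
lemma wordCount_bounds [MeasurableSingletonClass A] [IsProbabilityMeasure P]
    (hst : IsStationary P) {η : ℝ} (hη : η < 1) {ρ : ℕ → ℝ} {n m : ℕ} (hr : (r : ℝ) < ρ n)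
    (hr2 : (r : ℝ) < ρ (2 * n)) (hrn : (r : ℝ) < n / 2) {x : ℕ → A}
    (hx : x ∈ typicalEvent P η ρ n ∩ typicalEvent P η ρ (2 * n)) (hm1 : n ≤ r + m)
    (hm2 : r + m ≤ 2 * n) (hpos : 0 < P.real (prefixEvent (r + m) x)) (a : Fin r → A) :
    (1 - η) * P.real (blockEvent 0 a) * ((n : ℝ) - r) ≤ wordCount m a x ∧
      (wordCount m a x : ℝ) ≤
        6 / (1 - η) * ((1 - η) * P.real (blockEvent 0 a) * ((n : ℝ) - r)) := by
  -- The typical event says nothing about null words; by stationarity they do not occur in a prefix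
  -- of positive probability.
  rcases (measureReal_nonneg (μ := P) (s := blockEvent 0 a)).eq_or_lt with h0 | ha
  · have : wordCount m a x = 0 := by
      classical
      refine Finset.card_eq_zero.2 (Finset.filter_eq_empty_iff.2 fun j hj hja => ?_)
      rw [Finset.mem_range] at hj
      have hsub : prefixEvent (r + m) x ⊆ blockEvent j a := fun y hy => by
        rw [mem_prefixEvent] at hy
        rw [← hja]
        exact block_congr fun i hi => hy i (by omega)
      have h1 := measureReal_mono (μ := P) hsub
      rw [measureReal_def P (blockEvent j a), hst.measure_blockEvent, ← measureReal_def, ← h0] at h1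
      linarith
    simp [← h0, this]
  have hn : r ≤ n := by
    have : (r : ℝ) ≤ n := by linarith [Nat.cast_nonneg (α := ℝ) n]
    exact_mod_cast this
  have hd : 0 < (n : ℝ) - r := by linarith [Nat.cast_nonneg (α := ℝ) r]
  have hd2 : 0 < ((2 * n : ℕ) : ℝ) - r := by
    push_cast
    linarith [Nat.cast_nonneg (α := ℝ) n]
  have h1 := (abs_le.1 (hx.1 r hr a ha)).1
  have h2 := (abs_le.1 (hx.2 r hr2 a ha)).2
  rw [blockCount_eq_wordCount hn, div_mul_div_comm, one_mul, le_sub_iff_add_le,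
    le_div_iff₀ (by positivity)] at h1
  rw [blockCount_eq_wordCount (by omega), div_mul_div_comm, one_mul, sub_le_iff_le_add,
    div_le_iff₀ (by positivity)] at h2
  have hm : (wordCount (n - r) a x : ℝ) ≤ wordCount m a x := by
    exact_mod_cast wordCount_mono a x (show n - r ≤ m by omega)
  have hm' : (wordCount m a x : ℝ) ≤ wordCount (2 * n - r) a x := by
    exact_mod_cast wordCount_mono a x (show m ≤ 2 * n - r by omega)
  refine ⟨by linarith, ?_⟩
  have hη' : 0 < 1 - η := by linarith
  -- The 6 comes from `1 + η ≤ 2` and from `2n - r ≤ 3 (n - r)`, which holds because `r < n / 2`.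
  have e : 6 / (1 - η) * ((1 - η) * P.real (blockEvent 0 a) * ((n : ℝ) - r)) =
      2 * (P.real (blockEvent 0 a) * (3 * ((n : ℝ) - r))) := by
    field_simp; ring
  rw [e]
  refine hm'.trans (h2.trans ?_)
  push_cast at hd2 ⊢
  gcongr
  · linarith
  · linarith

lemma HasTransition.real_typicalEvent_inter_le [MeasurableSingletonClass A]
    [IsProbabilityMeasure P] (h : HasTransition P r p) (hst : IsStationary P) {η : ℝ} (hη : η < 1)
    {ρ : ℕ → ℝ} {n : ℕ} (hr : (r : ℝ) < ρ n) (hr2 : (r : ℝ) < ρ (2 * n))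
    (hrn : (r : ℝ) < n / 2) (hn : 1 ≤ n) {ε : ℝ} (hε : 0 ≤ ε) :
    P.real ((typicalEvent P η ρ n ∩ typicalEvent P η ρ (2 * n)) ∩
      {x | (ε : EReal) ≤ ⨆ i ∈ Icc n (2 * n), (maxLogLik r i x - condLogLik P r i x)}) ≤
      ((Real.exp (-1 / 4) / 4) ^ (Fintype.card A ^ r * Fintype.card A) *
        Real.exp (ε / (4 * (6 / (1 - η)))))⁻¹ := by
  classical
  have hη' : 0 < 1 - η := by linarith
  have hnr : 0 < (n : ℝ) - r := by linarith [Nat.cast_nonneg (α := ℝ) r]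
  obtain ⟨J, hJ⟩ := exists_mixture_ge (K := 6 / (1 - η)) (by positivity) ε
  -- The grid is built from a deterministic lower bound for the compensator, so the parameters do
  -- not depend on the path.
  choose θ hθ using fun a : (Fin r → A) × A =>
    hJ ((1 - η) * P.real (blockEvent 0 a.1) * ((n : ℝ) - r) * p a.1 a.2)
      (mul_nonneg (by positivity) (h.nonneg _ _))
  refine le_trans ?_ ((h.isSupermartingale_mixMartingale θ).real_exists_ge_le
    (mixMartingale_zero_le_one p θ) (by positivity) (2 * n))
  refine ENNReal.toReal_mono (measure_ne_top _ _) (measure_mono_ae ?_)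
  have hnull : ∀ᵐ x ∂P, P (prefixEvent (2 * n) x) ≠ 0 := by
    rw [ae_iff]
    simpa using measure_prefixEvent_eq_zero P (2 * n)
  filter_upwards [hnull] with x hx0
  rintro ⟨hxt, hxε⟩
  obtain ⟨i, hi, hεi⟩ : ∃ i ∈ Icc n (2 * n), (ε : EReal) ≤ maxLogLik r i x - condLogLik P r i x := by
    obtain ⟨i, hi, hmax⟩ := (Icc n (2 * n)).exists_max_image
      (fun i => maxLogLik r i x - condLogLik P r i x) ⟨n, by simp; omega⟩
    exact ⟨i, hi, le_trans hxε (iSup₂_le hmax)⟩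
  rw [Finset.mem_Icc] at hi
  have hrn' : r ≤ n := by
    have : (r : ℝ) ≤ n := by linarith
    exact_mod_cast this
  obtain ⟨m, rfl⟩ := Nat.exists_eq_add_of_le (hrn'.trans hi.1)
  have hpos : 0 < P.real (prefixEvent (r + m) x) :=
    (ENNReal.toReal_pos hx0 (measure_ne_top _ _)).trans_le
      (measureReal_mono (prefixEvent_anti hi.2 x))
  -- Truncating each entropy at `ε` makes the finite grid sufficient without losing the lower bound
  -- `ε` on the sum.
  have hsum := le_sum_min (h.poissonEntropy_nonneg hpos) hε
    (EReal.coe_le_coe_iff.1 (hεi.trans (h.maxLogLik_sub_condLogLik_le hpos)))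
  refine ⟨m, by omega, ?_⟩
  calc (Real.exp (-1 / 4) / 4) ^ (Fintype.card A ^ r * Fintype.card A) *
        Real.exp (ε / (4 * (6 / (1 - η))))
      ≤ (Real.exp (-1 / 4) / 4) ^ (Fintype.card A ^ r * Fintype.card A) *
        Real.exp ((∑ a : (Fin r → A) × A, min (poissonEntropy (transCount m a x)
          (wordCount m a.1 x * p a.1 a.2)) ε) / (4 * (6 / (1 - η)))) := by
        gcongr
    _ = ∏ a : (Fin r → A) × A, (Real.exp (-1 / 4) / 4 * Real.exp (min (poissonEntropy
          (transCount m a x) (wordCount m a.1 x * p a.1 a.2)) ε / (4 * (6 / (1 - η))))) := by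
        rw [Finset.prod_mul_distrib, ← Real.exp_sum, Finset.sum_div]
        simp [div_pow]
    _ ≤ mixMartingale p θ m x := by
        refine Finset.prod_le_prod (fun a _ => by positivity) fun a _ => ?_
        obtain ⟨hb1, hb2⟩ := wordCount_bounds hst hη hr hr2 hrn hxt hi.1 hi.2 hpos a.1
        refine hθ a _ _ (Nat.cast_nonneg _) (mul_le_mul_of_nonneg_right hb1 (h.nonneg _ _)) ?_
          (h.eq_zero_of_mul_eq_zero hpos)
        rw [← mul_assoc]
        exact mul_le_mul_of_nonneg_right hb2 (h.nonneg _ _)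

end MarkovOrder

theorem proposition1 (η : ℝ) (hη : η < 1) :
    ∃ (C₁ C₁' : ℝ) (C₂ : ℕ → ℝ), 0 < C₁ ∧ 0 < C₁' ∧ (∀ k, 0 < C₂ k) ∧
      ∀ (A : Type*) [Fintype A] [MeasurableSpace A] [MeasurableSingletonClass A]
        (Pstar : Measure (ℕ → A)) (rstar : ℕ),
        MarkovOrder.HasOrder Pstar rstar →
        MarkovOrder.IsStationary Pstar →
        MarkovOrder.IsIrreducible Pstar rstar →
      ∀ ρ : ℕ → ℝ, MonotoneOn ρ (Set.Ici 1) → (∀ n : ℕ, 1 ≤ n → ρ n ≤ (n : ℝ) / 2) →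
      ∀ (n : ℕ), 1 ≤ n → ∀ (r : ℕ), rstar < r → (r : ℝ) < ρ n →
      ∀ ε : ℝ, C₂ (Fintype.card A) * (Fintype.card A : ℝ) ^ r ≤ ε →
        Pstar.real
          ((MarkovOrder.typicalEvent Pstar η ρ n ∩ MarkovOrder.typicalEvent Pstar η ρ (2 * n)) ∩
            {x | (ε : EReal) ≤ ⨆ i ∈ Finset.Icc n (2 * n),
              (MarkovOrder.maxLogLik r i x - MarkovOrder.condLogLik Pstar r i x)})
          ≤ C₁' * Real.exp (-ε / C₁) := by
  have hη' : 0 < 1 - η := by linarith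
  set G : ℝ := 4 * (6 / (1 - η)) with hG
  have hG0 : 0 < G := by positivity
  set c : ℝ := Real.exp (-1 / 4) / 4 with hc
  have hc0 : 0 < c := by positivity
  have hc1 : c ≤ 1 := by
    have : Real.exp (-1 / 4) ≤ 1 := Real.exp_le_one_iff.2 (by norm_num)
    linarith
  have hL : 0 ≤ -Real.log c := neg_nonneg.2 (Real.log_nonpos hc0.le hc1)
  -- Of the exponent `ε / G`, one half pays for `c ^ (-|A| ^ (r + 1))` and the other is the final
  -- rate. The factor `k` supplies the extra power of `|A|`; the `+ 1` secures positivity.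
  refine ⟨2 * G, 1, fun k => 2 * G * (-Real.log c) * k + 1, by positivity, one_pos,
    fun k => by positivity, ?_⟩
  intro A _ _ _ P s hord hst _ ρ hρ hρn n hn r hsr hr ε hε
  obtain ⟨hP, p, hp0, hp1, hp⟩ := MarkovOrder.markovClass_mono hsr.le hord.1
  have hr2 : (r : ℝ) < ρ (2 * n) :=
    hr.trans_le (hρ (Set.mem_Ici.2 hn) (Set.mem_Ici.2 (by omega)) (by omega))
  have hε0 : 0 ≤ ε := le_trans (by positivity) hε
  refine (MarkovOrder.HasTransition.real_typicalEvent_inter_le ⟨hp0, hp1, hp⟩ hst hη hr hr2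
    (hr.trans_le (hρn n hn)) hn hε0).trans ?_
  rw [← hG, ← hc, one_mul, ← Real.exp_log hc0, ← Real.exp_nat_mul, ← Real.exp_add, ← Real.exp_neg,
    Real.exp_le_exp]
  have h1 : 2 * G * (-Real.log c) * ((Fintype.card A : ℝ) ^ r * Fintype.card A) ≤ ε := by
    refine le_trans ?_ hε
    have : (0 : ℝ) ≤ (Fintype.card A : ℝ) ^ r := by positivity
    nlinarith
  have h2 : (-Real.log c) * ((Fintype.card A : ℝ) ^ r * Fintype.card A) ≤ ε / (2 * G) := by
    rw [le_div_iff₀ (by positivity)]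
    linarith
  have h3 : ε / G = ε / (2 * G) + ε / (2 * G) := by field_simp; ring
  push_cast
  rw [h3, neg_div]
  linarith
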